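/- Let $F$ be a field and let $x_1,\dots,x_n$ be variables. An roABP over $F$ in the variable order $\pi$ (a permutation of $\{1,\dots,n\}$) is a layered directed graph with layers $0,1,\dots,n$, a source in layer $0$ and a sink in layer $n$, in which every edge goes from some layer $i-1$ to layer $i$ and is labelled by a univariate polynomial in $x_{\pi(i)}$ over $F$. It computes the sum, over all source-to-sink paths, of the product of the edge labels on the path. Its width is the maximum number of vertices in a layer. For a simple graph $G=(V,E)$ with $V=\{1,\dots,n\}$ put $Q_G=\sum_{\{i,j\}\in E}x_ix_j$. For $k\in\mathbb N$ and real $h>0$ call $G$ a $(k,h)$-expander if every vertex has degree at most $k$ and every $S\subseteq V$ with $|S|\le n/2$ has at least $h|S|$ edges to its complement. Then: 1. There are $k\in\mathbb N$ and $h>0$ such that for every $n$ there is a $(k,h)$-expander on $n$ vertices. 2. For all $k\in\mathbb N$ and $h>0$ there are constants $C,c>0$ and $n_0$, depending only on $k$ and $h$, such that for every $n\ge n_0$ and every $(k,h)$-expander $G$ on $n$ vertices there is an integer $m\ge cn$ such that the following holds over every field of characteristic zero. The polynomial $Q_G$ has degree $2$; it is computed by an roABP of width at most $Cn$ in every variable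 order; and for every integer $d\ge 0$, every roABP computing $Q_G^d$, in any variable order, has width at least $\binom{d+m}{m}$. In particular, for all sufficiently large $n$ there is an $n$-variate quadratic polynomial $Q$ (the same for all fields of characteristic zero) computable by an roABP of width $O(n)$, such that for every $d$ every roABP computing $Q^d$ has width at least $\binom{d+m}{m}$ in every variable order, where $m=\Omega(n)$. -/

import Mathlib

noncomputable section

/-- A read-once oblivious algebraic branching program over `F` in the variables `x_0, …, x_{n-1}`,
reading them in the order `π 0, π 1, …`. The vertices of layer `i` (for `0 ≤ i ≤ n`) are
`Fin (size i)`; the edge from vertex `a` of layer `i` to vertex `b` of layer `i + 1` is labelled by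
the univariate polynomial `label i a b` in the variable `x_{π i}` (label `0` for a missing edge). -/
structure ROABP (F : Type*) [Field F] {n : ℕ} (π : Equiv.Perm (Fin n)) where
  size : Fin (n + 1) → ℕ
  source : Fin (size 0)
  sink : Fin (size (Fin.last n))
  label : (i : Fin n) → Fin (size i.castSucc) → Fin (size i.succ) → Polynomial F

namespace ROABP

variable {F : Type*} [Field F] {n : ℕ} {π : Equiv.Perm (Fin n)}

/-- A source-to-sink path picks one vertex in each layer, starting at the source and ending at
the sink. -/
def IsPath (P : ROABP F π) (γ : (i : Fin (n + 1)) → Fin (P.size i)) : Prop :=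
  γ 0 = P.source ∧ γ (Fin.last n) = P.sink

/-- The weight of a path: the product of the labels of its edges, the `i`-th label being
evaluated at the variable `x_{π i}`. -/
def weight (P : ROABP F π) (γ : (i : Fin (n + 1)) → Fin (P.size i)) : MvPolynomial (Fin n) F :=
  ∏ i : Fin n, Polynomial.aeval (MvPolynomial.X (π i)) (P.label i (γ i.castSucc) (γ i.succ))

open Classical in
/-- The polynomial computed by the program: the sum of the weights of all source-to-sink paths. -/
def poly (P : ROABP F π) : MvPolynomial (Fin n) F :=
  ∑ γ : (i : Fin (n + 1)) → Fin (P.size i) with P.IsPath γ, P.weight γ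

/-- The width: the maximum number of vertices in a layer. -/
def width (P : ROABP F π) : ℕ :=
  Finset.univ.sup P.size

end ROABP

open Classical in
/-- The quadratic polynomial `Q_G = ∑ x_i x_j`, summed over the (undirected) edges `{i, j}` of `G`,
each edge being counted once. -/
def graphQuadratic (F : Type*) [Field F] {n : ℕ} (G : SimpleGraph (Fin n)) :
    MvPolynomial (Fin n) F :=
  ∑ p : Fin n × Fin n with p.1 < p.2 ∧ G.Adj p.1 p.2, MvPolynomial.X p.1 * MvPolynomial.X p.2

open Classical in
/-- `G` has maximum degree at most `k` and edge expansion (Cheeger constant) at least `h`: every set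
`S` of at most half of the vertices sends at least `h * |S|` edges to its complement. -/
structure IsExpander {V : Type*} [Fintype V] (G : SimpleGraph V) (k : ℕ) (h : ℝ) : Prop where
  degree_le : ∀ v, G.degree v ≤ k
  expansion : ∀ S : Finset V, 2 * S.card ≤ Fintype.card V →
    h * (S.card : ℝ) ≤ ((S ×ˢ Sᶜ).filter fun p => G.Adj p.1 p.2).card

end

/-!
Expanders exist by counting. Eight permutations of `Fin n`, with all pairs `x, p i x` joined, fail
to give an expander only if some `S` of size `s ≤ n / 2` and some `R` of size `s / 20` satisfy
`p i '' S ⊆ S ∪ R` for all `i`. For fixed `S` and `R` this happens with probability at most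
`(C(s + s / 20, s) / C(n, s)) ^ 8 ≤ C(n, s) ^ (-4)`, there are at most `C(n, s) ^ 2` choices of
`S` and `R`, and `n ≤ C(n, s)`; so the failures of all sizes together have probability less than `1`
(`union_bound_term_le`, `exists_isExpander`).

For the upper bound on the width, a program remembers whether it has not yet read a variable of a
monomial, has read `x_i` and waits for the partner of `x_i`, or has finished a monomial
(`exists_roabp_graphQuadratic`).

For the lower bound, a program is cut at its middle layer. This writes the computed polynomial as a
sum of `w` products of a polynomial in the variables read before the cut and one in the variables
read after it, where `w` is the size of the layer (`ROABP.exists_aeval_poly_eq_sum_mul`). By expansion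
linearly many edges of `G` cross the cut, and since degrees are bounded a largest family
of them no two of which touch is an induced matching `u_j — v_j` of linear size
(`exists_induced_matching`). Setting all other
variables to zero turns `Q_G` into `∑ j, u_j v_j`. The coefficient matrix of the `d`-th power of this
form, with rows the monomials of degree `d` in the `u_j` and columns those in the `v_j`, is diagonal
with multinomial coefficients on the diagonal, which do not vanish in characteristic zero; its rank
is at most `w` (`choose_le_of_sum_mul_pow_eq`). With `m + 1` matching edges there are
`C(d + m, m)` such monomials.
-/

open Finset

/-! ### Counting permutations -/

theorem card_perm_image_eq_le {α : Type*} [Fintype α] [DecidableEq α] (S U : Finset α) :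
    #{p : Equiv.Perm α | S.image p = U} ≤ (#S).factorial * (Fintype.card α - #S).factorial := by
  classical
  rcases Finset.eq_empty_or_nonempty ({p : Equiv.Perm α | S.image p = U} : Finset _) with
    h | ⟨p₀, h₀⟩
  · rw [h]; simp
  have h₀ : S.image p₀ = U := by simpa using h₀
  -- dividing by a fixed permutation `p₀` with `p₀ S = U` leads to permutations preserving `S`,
  -- which split into a permutation of `S` and one of its complement
  have key : ∀ p : {p : Equiv.Perm α // S.image p = U}, ∀ x,
      x ∈ S ↔ (p.1.trans p₀.symm) x ∈ S := by
    rintro ⟨p, hp⟩ x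
    have : p x ∈ S.image p ↔ p x ∈ S.image p₀ := by rw [hp, h₀]
    simp only [mem_image, EmbeddingLike.apply_eq_iff_eq, exists_eq_right] at this
    rw [this]
    simp only [Equiv.trans_apply]
    constructor
    · rintro ⟨a, ha, e⟩; rw [← e]; simpa using ha
    · intro h; exact ⟨_, h, by simp⟩
  let f : {p : Equiv.Perm α // S.image p = U} →
      Equiv.Perm {x // x ∈ S} × Equiv.Perm {x // ¬ x ∈ S} := fun p =>
    ((p.1.trans p₀.symm).subtypeEquiv (key p),
      (p.1.trans p₀.symm).subtypeEquiv (fun x => not_congr (key p x)))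
  have hf : Function.Injective f := by
    rintro ⟨p, hp⟩ ⟨q, hq⟩ hpq
    ext x
    simp only [f, Prod.mk.injEq] at hpq
    by_cases hx : x ∈ S
    · have := congrArg Subtype.val (DFunLike.congr_fun hpq.1 ⟨x, hx⟩)
      simpa using this
    · have := congrArg Subtype.val (DFunLike.congr_fun hpq.2 ⟨x, hx⟩)
      simpa using this
  have := Fintype.card_le_of_injective f hf
  rw [Fintype.card_prod, Fintype.card_perm, Fintype.card_perm, Fintype.card_subtype,
    Fintype.card_subtype_compl, Fintype.card_coe] at this
  exact this

theorem card_perm_image_subset_le {α : Type*} [Fintype α] [DecidableEq α] (S T : Finset α) :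
    #{p : Equiv.Perm α | S.image p ⊆ T} ≤
      (#T).choose #S * ((#S).factorial * (Fintype.card α - #S).factorial) := by
  classical
  have hsub : ({p : Equiv.Perm α | S.image p ⊆ T} : Finset _) ⊆
      (T.powersetCard #S).biUnion fun U => {p : Equiv.Perm α | S.image p = U} := by
    intro p hp
    simp only [mem_filter, mem_univ, true_and, mem_biUnion, mem_powersetCard] at hp ⊢
    exact ⟨_, ⟨hp, card_image_of_injective _ p.injective⟩, rfl⟩
  refine (card_le_card hsub).trans (card_biUnion_le.trans ?_)
  refine (sum_le_sum fun U _ => card_perm_image_eq_le S U).trans ?_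
  rw [sum_const, card_powersetCard, smul_eq_mul]

/-! ### Binomial estimates -/

theorem Nat.choose_le_choose_of_le_half {n r s : ℕ} (hrs : r ≤ s) (hs : 2 * s ≤ n) :
    n.choose r ≤ n.choose s := by
  induction s, hrs using Nat.le_induction with
  | base => rfl
  | succ s _ ih =>
    exact (ih (by omega)).trans (Nat.choose_le_succ_of_lt_half_left (by omega))

theorem Nat.two_pow_le_centralBinom (s : ℕ) : 2 ^ s ≤ s.centralBinom := by
  induction s with
  | zero => simp
  | succ s ih =>
    have h := Nat.succ_mul_centralBinom_succ s
    have : (s + 1) * 2 ^ (s + 1) ≤ (s + 1) * (s + 1).centralBinom := by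
      rw [h, pow_succ]; nlinarith
    exact Nat.le_of_mul_le_mul_left this (Nat.succ_pos s)

/-- Few extra vertices cost little: enlarging a set of size `s` by a twentieth leaves at most
`2 ^ (s / 2)` subsets of size `s`, which follows from `(8 + 1) ^ (s + r) ≥ C(s + r, s) * 8 ^ s` and
`81 ^ 21 ≤ 128 ^ 20`. -/
theorem Nat.choose_sq_le_two_pow {s r : ℕ} (h : 20 * r ≤ s) : (s + r).choose s ^ 2 ≤ 2 ^ s := by
  have h1 : 8 ^ s * (s + r).choose s ≤ 9 ^ (s + r) := by
    have := add_pow 8 1 (s + r)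
    rw [show 8 + 1 = 9 from rfl] at this
    rw [this]
    have h2 := single_le_sum (f := fun m => 8 ^ m * 1 ^ (s + r - m) * (s + r).choose m)
      (fun _ _ => Nat.zero_le _) (mem_range.2 (show s < s + r + 1 by omega))
    simpa using h2
  have h2 : 81 ^ (s + r) ≤ 128 ^ s := by
    have : (81 ^ (s + r)) ^ 20 ≤ (128 ^ s) ^ 20 := by
      calc (81 ^ (s + r)) ^ 20 = 81 ^ (20 * s + 20 * r) := by rw [← pow_mul]; congr 1; ring
        _ ≤ 81 ^ (21 * s) := Nat.pow_le_pow_right (by norm_num) (by omega)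
        _ = (81 ^ 21) ^ s := by rw [pow_mul]
        _ ≤ (128 ^ 20) ^ s := Nat.pow_le_pow_left (by norm_num) s
        _ = (128 ^ s) ^ 20 := by rw [← pow_mul, ← pow_mul, mul_comm]
    exact le_of_pow_le_pow_left₀ (by norm_num) (Nat.zero_le _) this
  have h3 : 64 ^ s * (s + r).choose s ^ 2 ≤ 64 ^ s * 2 ^ s := by
    calc 64 ^ s * (s + r).choose s ^ 2 = (8 ^ s * (s + r).choose s) ^ 2 := by
          rw [mul_pow, ← pow_mul, mul_comm s 2, pow_mul]; norm_num
      _ ≤ (9 ^ (s + r)) ^ 2 := Nat.pow_le_pow_left h1 2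
      _ = 81 ^ (s + r) := by rw [← pow_mul, mul_comm, pow_mul]; norm_num
      _ ≤ 128 ^ s := h2
      _ = 64 ^ s * 2 ^ s := by rw [← mul_pow]; norm_num
  exact Nat.le_of_mul_le_mul_left h3 (by positivity)

theorem Nat.choose_sq_le_choose {n s r : ℕ} (h : 20 * r ≤ s) (hs : 2 * s ≤ n) :
    (s + r).choose s ^ 2 ≤ n.choose s :=
  (Nat.choose_sq_le_two_pow h).trans <| (Nat.two_pow_le_centralBinom s).trans <| by
    rw [Nat.centralBinom]; exact Nat.choose_mono s hs

/-! ### Existence of expanders -/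

/-- The estimate behind the union bound: the bad events belonging to sets of size `s` make up at
most a fraction `1 / n ^ 2` of all `8`-tuples of permutations. -/
theorem union_bound_term_le {n s r : ℕ} (h : 20 * r ≤ s) (h1 : 1 ≤ s) (hs : 2 * s ≤ n) :
    n ^ 2 * (n.choose s * (n.choose r *
      ((s + r).choose s * (s.factorial * (n - s).factorial)) ^ 8)) ≤ n.factorial ^ 8 := by
  have hN : n.choose s * (s.factorial * (n - s).factorial) = n.factorial := by
    rw [← mul_assoc]; exact Nat.choose_mul_factorial_mul_factorial (by omega)
  have hn : n ≤ n.choose s := by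
    simpa using Nat.choose_le_choose_of_le_half h1 hs
  have hr : n.choose r ≤ n.choose s := Nat.choose_le_choose_of_le_half (by omega) hs
  have hD := Nat.choose_sq_le_choose h hs
  rw [← hN]
  generalize n.choose s = N at *
  generalize s.factorial * (n - s).factorial = K at *
  generalize (s + r).choose s = D at *
  calc n ^ 2 * (N * (n.choose r * (D * K) ^ 8))
      = n ^ 2 * (N * (n.choose r * ((D ^ 2) ^ 4 * K ^ 8))) := by ring
    _ ≤ N ^ 2 * (N * (N * (N ^ 4 * K ^ 8))) := by gcongr
    _ = (N * K) ^ 8 := by ring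

/-- Some eight permutations expand all small sets: each `S` with `1 ≤ |S| ≤ n / 2` has more than
`|S| / 20` images outside `S`. The proof counts the tuples violating this. -/
theorem exists_expanding_perms (n : ℕ) : ∃ p : Fin 8 → Equiv.Perm (Fin n),
    ∀ S : Finset (Fin n), S.Nonempty → 2 * #S ≤ n →
      #S / 20 < #((univ.biUnion fun i => S.image (p i)) \ S) := by
  classical
  rcases Nat.eq_zero_or_pos n with rfl | hn
  · exact ⟨fun _ => 1, fun S ⟨x, _⟩ => x.elim0⟩
  by_contra! hcon
  let bad : Finset (Fin n) → Finset (Fin n) → Finset (Fin 8 → Equiv.Perm (Fin n)) := fun S R =>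
    Fintype.piFinset fun _ => {q : Equiv.Perm (Fin n) | S.image q ⊆ S ∪ R}
  have hcover : (univ : Finset (Fin 8 → Equiv.Perm (Fin n))) ⊆
      (Icc 1 (n / 2)).biUnion fun s => (powersetCard s univ).biUnion fun S =>
        (powersetCard (s / 20) univ).biUnion fun R => bad S R := by
    intro p _
    obtain ⟨S, hS, hSn, hle⟩ := hcon p
    obtain ⟨R, hR, hRc⟩ := exists_superset_card_eq hle (by rw [Fintype.card_fin]; omega)
    simp only [mem_biUnion, mem_Icc, mem_powersetCard, subset_univ, true_and, bad,
      Fintype.mem_piFinset, mem_filter, mem_univ]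
    refine ⟨#S, ⟨hS.card_pos, by omega⟩, S, rfl, R, hRc, fun i => ?_⟩
    intro y hy
    by_cases hyS : y ∈ S
    · exact mem_union_left _ hyS
    · exact mem_union_right _ (hR (mem_sdiff.2 ⟨mem_biUnion.2 ⟨i, mem_univ _, hy⟩, hyS⟩))
  have hbad : ∀ s, ∀ S ∈ powersetCard s (univ : Finset (Fin n)),
      ∀ R ∈ powersetCard (s / 20) (univ : Finset (Fin n)), #(bad S R) ≤
        ((s + s / 20).choose s * (s.factorial * (n - s).factorial)) ^ 8 := by
    intro s S hS R hR
    simp only [mem_powersetCard, subset_univ, true_and] at hS hR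
    simp only [bad, Fintype.card_piFinset, prod_const, card_univ, Fintype.card_fin]
    refine Nat.pow_le_pow_left ((card_perm_image_subset_le S (S ∪ R)).trans ?_) 8
    rw [hS, Fintype.card_fin]
    refine Nat.mul_le_mul_right _ (Nat.choose_mono s ?_)
    exact (card_union_le _ _).trans (by omega)
  have hcount : n.factorial ^ 8 ≤ ∑ s ∈ Icc 1 (n / 2), n.choose s * (n.choose (s / 20) *
      ((s + s / 20).choose s * (s.factorial * (n - s).factorial)) ^ 8) := by
    have h0 := card_le_card hcover
    rw [card_univ, Fintype.card_fun, Fintype.card_perm, Fintype.card_fin, Fintype.card_fin] at h0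
    refine h0.trans (card_biUnion_le.trans (sum_le_sum fun s _ => ?_))
    refine (card_biUnion_le_card_mul _ _ _ fun S hS => ?_).trans_eq
      (by rw [card_powersetCard, card_univ, Fintype.card_fin])
    exact (card_biUnion_le_card_mul _ _ _ fun R hR => hbad s S hS R hR).trans_eq
      (by rw [card_powersetCard, card_univ, Fintype.card_fin])
  have hsum := Nat.mul_le_mul_left (n ^ 2) hcount
  rw [mul_sum] at hsum
  have hsum2 := hsum.trans (sum_le_card_nsmul _ _ (n.factorial ^ 8) fun s hs => by
    rw [mem_Icc] at hs
    exact union_bound_term_le (by omega) hs.1 (by omega))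
  rw [Nat.card_Icc, smul_eq_mul] at hsum2
  have := Nat.le_of_mul_le_mul_right hsum2 (by positivity)
  have : n ≤ n ^ 2 := Nat.le_self_pow (by norm_num) n
  omega

theorem exists_isExpander (n : ℕ) : ∃ G : SimpleGraph (Fin n), IsExpander G 16 (1 / 20) := by
  classical
  obtain ⟨p, hp⟩ := exists_expanding_perms n
  let G : SimpleGraph (Fin n) := SimpleGraph.fromRel fun x y => ∃ i, p i x = y
  refine ⟨G, ⟨fun v => ?_, fun S hS => ?_⟩⟩
  · have hsub : G.neighborFinset v ⊆
        univ.image fun c : Fin 8 × Bool => bif c.2 then p c.1 v else (p c.1).symm v := by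
      intro w hw
      rw [SimpleGraph.mem_neighborFinset, SimpleGraph.fromRel_adj] at hw
      simp only [mem_image, mem_univ, true_and, Prod.exists]
      rcases hw.2 with ⟨i, hi⟩ | ⟨i, hi⟩
      · exact ⟨i, true, hi⟩
      · exact ⟨i, false, by simp [← hi]⟩
    have h16 := (card_le_card hsub).trans card_image_le
    rw [SimpleGraph.card_neighborFinset_eq_degree] at h16
    simp only [card_univ, Fintype.card_prod, Fintype.card_fin, Fintype.card_bool] at h16
    convert! h16
  · rcases S.eq_empty_or_nonempty with rfl | hne
    · simp
    rw [Fintype.card_fin] at hS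
    have h1 := hp S hne hS
    have hsub : (univ.biUnion fun i => S.image (p i)) \ S ⊆
        ((S ×ˢ Sᶜ).filter fun q => G.Adj q.1 q.2).image Prod.snd := by
      intro y hy
      simp only [mem_sdiff, mem_biUnion, mem_univ, true_and, mem_image] at hy
      obtain ⟨⟨i, x, hx, rfl⟩, hy⟩ := hy
      simp only [mem_image, mem_filter, mem_product, mem_compl]
      refine ⟨(x, p i x), ⟨⟨hx, hy⟩, ?_⟩, rfl⟩
      rw [SimpleGraph.fromRel_adj]
      exact ⟨fun h => hy (by rw [← show x = p i x from h]; exact hx), Or.inl ⟨i, rfl⟩⟩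
    have h2 := (card_le_card hsub).trans card_image_le
    have h3 : #S ≤ 20 * #((S ×ˢ Sᶜ).filter fun q => G.Adj q.1 q.2) := by omega
    have h4 : (#S : ℝ) ≤ 20 * (#((S ×ˢ Sᶜ).filter fun q => G.Adj q.1 q.2) : ℝ) := by
      exact_mod_cast h3
    have h5 : 1 / 20 * (#S : ℝ) ≤ (#((S ×ˢ Sᶜ).filter fun q => G.Adj q.1 q.2) : ℝ) := by
      linarith
    convert! h5

/-! ### Path sums and transfer vectors -/

/-- Path sums are computed layer by layer: if the vectors `V i` are propagated by the edge weights
`W i`, then summing `V 0 * ∏ W * g` over all paths gives `∑ V (last) * g`. -/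
theorem sum_paths_eq {R : Type*} [CommSemiring R] {n : ℕ} (s : Fin (n + 1) → ℕ)
    (W : (i : Fin n) → Fin (s i.castSucc) → Fin (s i.succ) → R)
    (V : (i : Fin (n + 1)) → Fin (s i) → R)
    (hV : ∀ i b, V i.succ b = ∑ a, V i.castSucc a * W i a b) (g : Fin (s (Fin.last n)) → R) :
    ∑ γ : (i : Fin (n + 1)) → Fin (s i),
      V 0 (γ 0) * (∏ i, W i (γ i.castSucc) (γ i.succ)) * g (γ (Fin.last n)) =
      ∑ b, V (Fin.last n) b * g b := by
  induction n with
  | zero =>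
    rw [← (Equiv.piUnique fun i : Fin 1 => Fin (s i)).symm.sum_comp]
    simp [Fin.last]
    rfl
  | succ n ih =>
    rw [← (Fin.consEquiv fun i : Fin (n + 2) => Fin (s i)).sum_comp, Fintype.sum_prod_type_right]
    refine Eq.trans (sum_congr rfl fun γ _ => ?_)
      (ih (fun i => s i.succ) (fun i => W i.succ) (fun i => V i.succ) (fun i => hV i.succ) g)
    have h0 : V (Fin.succ 0) (γ 0) = ∑ a, V 0 a * W 0 a (γ 0) := hV 0 (γ 0)
    rw [h0, sum_mul, sum_mul]
    refine sum_congr rfl fun a _ => ?_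
    rw [Fin.prod_univ_succ, ← mul_assoc]
    rfl

namespace ROABP

variable {F : Type*} [Field F] {n : ℕ} {π : Equiv.Perm (Fin n)}

/-- Evaluating the polynomial of a program by propagating vectors `V i` through its layers. -/
theorem aeval_poly_eq_of_transfer (P : ROABP F π) {R : Type*} [CommRing R] [Algebra F R]
    (x : Fin n → R) (V : (i : Fin (n + 1)) → Fin (P.size i) → R)
    (h0 : ∀ a, V 0 a = if a = P.source then 1 else 0)
    (hV : ∀ i b, V i.succ b = ∑ a, V i.castSucc a * Polynomial.aeval (x (π i)) (P.label i a b)) :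
    MvPolynomial.aeval x P.poly = V (Fin.last n) P.sink := by
  classical
  have key := sum_paths_eq P.size (fun i a b => Polynomial.aeval (x (π i)) (P.label i a b)) V hV
    (fun b => if b = P.sink then 1 else 0)
  simp only [mul_ite, mul_one, mul_zero, sum_ite_eq', mem_univ, if_true] at key
  rw [← key, poly, map_sum, sum_filter]
  refine sum_congr rfl fun γ _ => ?_
  rw [h0, IsPath]
  by_cases h1 : γ 0 = P.source <;> by_cases h2 : γ (Fin.last n) = P.sink <;>
    simp [h1, h2, weight, map_prod, ← Polynomial.aeval_algHom_apply]

theorem aeval_mem {R : Type*} [CommRing R] [Algebra F R] (A : Subalgebra F R) {y : R} (hy : y ∈ A)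
    (p : Polynomial F) : Polynomial.aeval y p ∈ A := by
  have := Polynomial.aeval_mem_adjoin_singleton F y (p := p)
  exact Algebra.adjoin_le (by simpa using hy) this

/-- Cutting a program at layer `j` writes the computed polynomial as a sum of `P.size j` products
of a polynomial in the variables read before the cut and one in those read after it. -/
theorem exists_aeval_poly_eq_sum_mul (P : ROABP F π) (j : Fin (n + 1)) {R : Type*} [CommRing R]
    [Algebra F R] (x : Fin n → R) (A B : Subalgebra F R)
    (hA : ∀ i : Fin n, i.castSucc < j → x (π i) ∈ A)
    (hB : ∀ i : Fin n, j ≤ i.castSucc → x (π i) ∈ B) :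
    ∃ a b : Fin (P.size j) → R, (∀ c, a c ∈ A) ∧ (∀ c, b c ∈ B) ∧
      MvPolynomial.aeval x P.poly = ∑ c, a c * b c := by
  classical
  let W : (i : Fin n) → Fin (P.size i.castSucc) → Fin (P.size i.succ) → R :=
    fun i a b => Polynomial.aeval (x (π i)) (P.label i a b)
  -- `V` sums over the paths from the source, `U` over the paths to the sink
  let V : (i : Fin (n + 1)) → Fin (P.size i) → R :=
    Fin.induction (fun a => if a = P.source then 1 else 0)
      (fun i v b => ∑ a, v a * W i a b)
  let U : (i : Fin (n + 1)) → Fin (P.size i) → R :=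
    Fin.reverseInduction (fun b => if b = P.sink then 1 else 0)
      (fun i u a => ∑ b, W i a b * u b)
  have hV0 : ∀ a, V 0 a = if a = P.source then 1 else 0 := fun a => rfl
  have hVs : ∀ i b, V i.succ b = ∑ a, V i.castSucc a * W i a b := fun i b => by
    simp only [V, Fin.induction_succ]
  have hUl : ∀ b, U (Fin.last n) b = if b = P.sink then 1 else 0 := fun b => by
    simp only [U, Fin.reverseInduction_last]
  have hUs : ∀ i a, U i.castSucc a = ∑ b, W i a b * U i.succ b := fun i a => by
    simp only [U, Fin.reverseInduction_castSucc]
  refine ⟨V j, U j, ?_, ?_, ?_⟩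
  · have : ∀ i : Fin (n + 1), i ≤ j → ∀ c, V i c ∈ A := by
      intro i
      induction i using Fin.induction with
      | zero =>
        intro _ c
        rw [hV0]
        split_ifs
        exacts [A.one_mem, A.zero_mem]
      | succ i ih =>
        intro hi c
        have hlt : i.castSucc < j := lt_of_lt_of_le Fin.castSucc_lt_succ hi
        rw [hVs]
        exact A.sum_mem fun a _ => A.mul_mem (ih hlt.le a) (aeval_mem A (hA i hlt) _)
    exact this j le_rfl
  · have : ∀ i : Fin (n + 1), j ≤ i → ∀ c, U i c ∈ B := by
      intro i
      induction i using Fin.reverseInduction with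
      | last =>
        intro _ c
        rw [hUl]
        split_ifs
        exacts [B.one_mem, B.zero_mem]
      | cast i ih =>
        intro hi c
        rw [hUs]
        exact B.sum_mem fun a _ =>
          B.mul_mem (aeval_mem B (hB i hi) _) (ih (hi.trans Fin.castSucc_lt_succ.le) a)
    exact this j le_rfl
  · have hinv : ∀ i : Fin (n + 1), ∑ c, V i c * U i c = MvPolynomial.aeval x P.poly := by
      intro i
      induction i using Fin.reverseInduction with
      | last =>
        rw [P.aeval_poly_eq_of_transfer x V hV0 hVs]
        simp [hUl]
      | cast i ih =>
        rw [← ih]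
        simp only [hUs, hVs, mul_sum, sum_mul]
        rw [sum_comm]
        simp only [mul_assoc]
    exact (hinv j).symm

theorem size_le_width (P : ROABP F π) (j : Fin (n + 1)) : P.size j ≤ P.width :=
  le_sup (f := P.size) (mem_univ j)

/-- A finite automaton with polynomial transition labels `W i a b` gives a program all of whose layers
are copies of its set of states; `V i a` is the polynomial accumulated on reaching state `a` in
layer `i`. -/
theorem exists_of_transfer {S : Type*} [Fintype S] [DecidableEq S] (s t : S)
    (W : Fin n → S → S → Polynomial F) (V : Fin (n + 1) → S → MvPolynomial (Fin n) F)
    (h0 : ∀ a, V 0 a = if a = s then 1 else 0)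
    (hV : ∀ i b, V i.succ b =
      ∑ a, V i.castSucc a * Polynomial.aeval (MvPolynomial.X (π i)) (W i a b)) :
    ∃ P : ROABP F π, P.poly = V (Fin.last n) t ∧ P.width = Fintype.card S := by
  let e := Fintype.equivFin S
  let P : ROABP F π :=
    { size := fun _ => Fintype.card S
      source := e s
      sink := e t
      label := fun i a b => W i (e.symm a) (e.symm b) }
  refine ⟨P, ?_, ?_⟩
  · have := P.aeval_poly_eq_of_transfer MvPolynomial.X (fun i a => V i (e.symm a))
      (fun a => by rw [h0]; simp only [Equiv.symm_apply_eq, P])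
      (fun i b => by
        rw [hV, ← e.symm.sum_comp])
    rw [MvPolynomial.aeval_X_left_apply] at this
    rw [this]
    simp [P]
  · simp only [width, P]
    exact sup_const univ_nonempty _

end ROABP

/-! ### A linear-width program for a quadratic form -/

/-- Twice the sum over the edges is the sum over the ordered adjacent pairs, whatever order on the
vertices (given by `σ`) selects one of the two orientations. -/
theorem two_mul_sum_adj {n : ℕ} (G : SimpleGraph (Fin n)) [DecidableRel G.Adj]
    {R : Type*} [CommRing R] (y : Fin n → R) (σ : Equiv.Perm (Fin n)) :
    2 * ∑ p : Fin n × Fin n with p.1 < p.2 ∧ G.Adj (σ p.1) (σ p.2), y (σ p.1) * y (σ p.2) =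
      ∑ p : Fin n × Fin n with G.Adj p.1 p.2, y p.1 * y p.2 := by
  have h1 : ∑ p : Fin n × Fin n with G.Adj p.1 p.2, y p.1 * y p.2 =
      ∑ p : Fin n × Fin n with G.Adj (σ p.1) (σ p.2), y (σ p.1) * y (σ p.2) := by
    rw [sum_filter, sum_filter, ← (σ.prodCongr σ).sum_comp]
    rfl
  have h2 : ∑ p : Fin n × Fin n with p.1 < p.2 ∧ G.Adj (σ p.1) (σ p.2), y (σ p.1) * y (σ p.2) =
      ∑ p : Fin n × Fin n with p.2 < p.1 ∧ G.Adj (σ p.1) (σ p.2), y (σ p.1) * y (σ p.2) := by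
    rw [sum_filter, sum_filter, ← (Equiv.prodComm _ _).sum_comp]
    refine sum_congr rfl fun p _ => ?_
    simp [G.adj_comm (σ p.1), mul_comm]
  rw [h1, two_mul]
  nth_rewrite 2 [h2]
  rw [sum_filter, sum_filter, sum_filter, ← sum_add_distrib]
  refine sum_congr rfl fun p _ => ?_
  rcases lt_trichotomy p.1 p.2 with h | h | h
  · simp [h, h.not_gt]
  · simp [h]
  · simp [h, h.not_gt]

theorem two_mul_aeval_graphQuadratic {F : Type*} [Field F] {n : ℕ} (G : SimpleGraph (Fin n))
    [DecidableRel G.Adj] {R : Type*} [CommRing R] [Algebra F R] (y : Fin n → R) :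
    2 * MvPolynomial.aeval y (graphQuadratic F G) =
      ∑ p : Fin n × Fin n with G.Adj p.1 p.2, y p.1 * y p.2 := by
  rw [← two_mul_sum_adj G y 1, graphQuadratic, map_sum]
  simp only [map_mul, MvPolynomial.aeval_X, Equiv.Perm.one_apply]
  congr 2
  exact filter_congr_decidable _ _ _

theorem graphQuadratic_eq_sum_perm {F : Type*} [Field F] [CharZero F] {n : ℕ}
    (G : SimpleGraph (Fin n)) [DecidableRel G.Adj] (σ : Equiv.Perm (Fin n)) :
    graphQuadratic F G = ∑ p : Fin n × Fin n with p.1 < p.2 ∧ G.Adj (σ p.1) (σ p.2),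
      MvPolynomial.X (σ p.1) * MvPolynomial.X (σ p.2) := by
  have h1 := two_mul_aeval_graphQuadratic (F := F) G (MvPolynomial.X (R := F))
  rw [MvPolynomial.aeval_X_left_apply, ← two_mul_sum_adj G MvPolynomial.X σ] at h1
  exact mul_left_cancel₀ two_ne_zero h1

/-- The program has a start state, a final state, and for each `i` a state in which the variable
`x_{π i}` has been read and waits for its partner. -/
theorem exists_roabp_graphQuadratic {F : Type*} [Field F] [CharZero F] {n : ℕ}
    (G : SimpleGraph (Fin n)) (π : Equiv.Perm (Fin n)) :
    ∃ P : ROABP F π, P.poly = graphQuadratic F G ∧ P.width = n + 2 := by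
  classical
  let W : Fin n → Bool ⊕ Fin n → Bool ⊕ Fin n → Polynomial F := fun j a b =>
    match a, b with
    | .inl false, .inl false => 1
    | .inl true, .inl true => 1
    | .inl false, .inr i => if i = j then Polynomial.X else 0
    | .inr i, .inr i' => if i = i' then 1 else 0
    | .inr i, .inl true => if G.Adj (π i) (π j) then Polynomial.X else 0
    | _, _ => 0
  let V : Fin (n + 1) → Bool ⊕ Fin n → MvPolynomial (Fin n) F := fun j a =>
    match a with
    | .inl false => 1
    | .inl true => ∑ i' : Fin n, if i'.castSucc < j then
        ∑ i : Fin n, if i < i' ∧ G.Adj (π i) (π i') then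
          MvPolynomial.X (π i) * MvPolynomial.X (π i') else 0 else 0
    | .inr i => if i.castSucc < j then MvPolynomial.X (π i) else 0
  have hlt : ∀ i j : Fin n, i.castSucc < j.succ ↔ i = j ∨ i.castSucc < j.castSucc := by
    intro i j
    rw [Fin.castSucc_lt_succ_iff, Fin.castSucc_lt_castSucc_iff, le_iff_eq_or_lt]
  obtain ⟨P, hP, hw⟩ := ROABP.exists_of_transfer (π := π) (.inl false) (.inl true) W V
    (by
      rintro ((_ | _) | i)
      · simp [V]
      · simp [V]
      · simp [V])
    (by
      rintro j ((_ | _) | i)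
      · simp [V, W, Fintype.sum_sum_type]
      · simp only [V, W, Fintype.sum_sum_type, Fintype.sum_bool, map_one, mul_one, map_zero,
          mul_zero, add_zero, apply_ite (Polynomial.aeval _), Polynomial.aeval_X, mul_ite,
          ite_mul, zero_mul]
        rw [← sum_erase_add _ _ (mem_univ j)]
        nth_rewrite 2 [← sum_erase_add _ _ (mem_univ j)]
        simp only [hlt, lt_irrefl, true_or, if_true, if_false, add_zero]
        congr 1
        · refine sum_congr rfl fun i hi => ?_
          simp [(mem_erase.1 hi).1]
        · refine sum_congr rfl fun i _ => ?_
          by_cases h1 : i < j <;> by_cases h2 : G.Adj (π i) (π j) <;> simp [h1, h2]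
      · simp only [V, W, Fintype.sum_sum_type, Fintype.sum_bool, map_one, mul_one, map_zero,
          mul_zero, zero_add, apply_ite (Polynomial.aeval _), Polynomial.aeval_X, mul_ite,
          one_mul, sum_ite_eq', mem_univ, if_true, hlt]
        by_cases h : i = j
        · simp [h]
        · simp [h])
  refine ⟨P, ?_, by rw [hw]; simp [add_comm]⟩
  rw [hP, graphQuadratic_eq_sum_perm G π, sum_filter, Fintype.sum_prod_type_right]
  simp [V, Fin.castSucc_lt_last]

/-! ### The rank lower bound -/

theorem card_finsuppAntidiag_fin (d m : ℕ) :
    #(finsuppAntidiag (univ : Finset (Fin (m + 1))) d) = (d + m).choose m := by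
  rw [card_finsuppAntidiag_nat_eq_choose, card_univ, Fintype.card_fin,
    ← Nat.choose_symm_add, Nat.add_right_comm, Nat.add_sub_cancel, Nat.add_comm]

open MvPolynomial in
/-- The coefficients of `(∑ j, u_j v_j) ^ d`, as a polynomial in the `v_j` over the polynomials in
the `u_j`: the coefficient matrix is diagonal, with multinomial coefficients as entries. -/
theorem coeff_coeff_sum_mul_pow {F J : Type*} [Field F] [Fintype J] [DecidableEq J] (d : ℕ)
    (α β : J →₀ ℕ) (hβ : β ∈ finsuppAntidiag univ d) :
    coeff α (coeff β ((∑ j : J, C (X j) * X j : MvPolynomial J (MvPolynomial J F)) ^ d)) =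
      if β = α then (Nat.multinomial univ β : F) else 0 := by
  have hterm : ∀ k : J → ℕ, ((Nat.multinomial univ k : ℕ) : MvPolynomial J (MvPolynomial J F)) *
      ∏ j, (C (X j) * X j) ^ k j = monomial (Finsupp.equivFunOnFinite.symm k)
        (monomial (Finsupp.equivFunOnFinite.symm k) (Nat.multinomial univ k : F)) := by
    intro k
    simp only [mul_pow, prod_mul_distrib]
    rw [monomial_eq, monomial_eq, Finsupp.prod_fintype _ _ (by simp),
      Finsupp.prod_fintype _ _ (by simp)]
    simp [map_prod, mul_assoc]
  rw [sum_pow_eq_sum_piAntidiag, coeff_sum, coeff_sum]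
  rw [mem_finsuppAntidiag] at hβ
  rw [sum_eq_single (β : J → ℕ)]
  · rw [hterm, coeff_monomial, if_pos (by ext; simp), coeff_monomial]
    simp
  · intro k _ hk
    rw [hterm, coeff_monomial, if_neg, coeff_zero]
    rintro rfl
    exact hk (by ext; simp)
  · intro h
    exact absurd (mem_piAntidiag.2 ⟨hβ.1, fun i _ => mem_univ i⟩) h

open MvPolynomial in
/-- If `(∑ j, u_j v_j) ^ d` is a sum of `w` products of a polynomial in the `u_j` and one in the
`v_j`, then `w` is at least the rank of the coefficient matrix. -/
theorem choose_le_of_sum_mul_pow_eq {F : Type*} [Field F] [CharZero F] {m d w : ℕ}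
    (a b : Fin w → MvPolynomial (Fin (m + 1)) F)
    (h : (∑ j, C (X j) * X j : MvPolynomial (Fin (m + 1)) (MvPolynomial (Fin (m + 1)) F)) ^ d =
      ∑ c, C (a c) * map C (b c)) :
    (d + m).choose m ≤ w := by
  classical
  let I := {α // α ∈ finsuppAntidiag (univ : Finset (Fin (m + 1))) d}
  let A : Matrix I (Fin w) F := fun α c => coeff α.1 (a c)
  let B : Matrix (Fin w) I F := fun c β => coeff β.1 (b c)
  let D : I → F := fun β => (Nat.multinomial univ β.1 : F)
  have hmul : A * B = Matrix.diagonal D := by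
    ext α β
    have := coeff_coeff_sum_mul_pow (F := F) d α.1 β.1 β.2
    have hterm : ∀ c, coeff α.1 (coeff β.1 (C (a c) * map C (b c))) = A α c * B c β := fun c => by
      rw [coeff_C_mul, coeff_map, mul_comm, coeff_C_mul, mul_comm]
    rw [h, coeff_sum, coeff_sum, sum_congr rfl fun c _ => hterm c] at this
    rw [Matrix.mul_apply, this, Matrix.diagonal_apply]
    by_cases hαβ : α = β
    · subst hαβ; simp [D]
    · rw [if_neg hαβ, if_neg fun h => hαβ (Subtype.ext h.symm)]
  have hD : ∀ β, D β ≠ 0 := fun β => Nat.cast_ne_zero.2 (Nat.multinomial_pos _ _).ne'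
  have hrank := Matrix.rank_diagonal D
  rw [← hmul] at hrank
  have h1 : (A * B).rank ≤ w :=
    (Matrix.rank_mul_le_left A B).trans (A.rank_le_card_width.trans_eq (Fintype.card_fin w))
  rw [hrank, Fintype.card_congr (Equiv.subtypeUnivEquiv hD), Fintype.card_coe,
    card_finsuppAntidiag_fin] at h1
  exact h1

/-! ### Induced matchings across a cut -/

/-- If every element of `A` is related to at most `D` elements of `A`, then `A` has a subset of at
least `|A| / D` pairwise unrelated elements: a largest such subset `M` works, since every element of
`A` is related to one of `M`. -/
theorem exists_independent_subset {T : Type*} [DecidableEq T] (r : T → T → Prop) [DecidableRel r]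
    (hr : ∀ x, r x x) (hs : ∀ x y, r x y → r y x) (A : Finset T) (D : ℕ)
    (hD : ∀ x ∈ A, #{y ∈ A | r x y} ≤ D) :
    ∃ M ⊆ A, (∀ x ∈ M, ∀ y ∈ M, x ≠ y → ¬ r x y) ∧ #A ≤ #M * D := by
  classical
  let fam := A.powerset.filter fun M => ∀ x ∈ M, ∀ y ∈ M, x ≠ y → ¬ r x y
  obtain ⟨M, hM, hmax⟩ := fam.exists_max_image card ⟨∅, by simp [fam]⟩
  simp only [fam, mem_filter, mem_powerset] at hM hmax
  refine ⟨M, hM.1, hM.2, ?_⟩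
  have hcov : A ⊆ M.biUnion fun x => {y ∈ A | r x y} := by
    intro y hy
    by_contra hcon
    simp only [mem_biUnion, mem_filter, not_exists, not_and] at hcon
    have hyM : y ∉ M := fun h => hcon y h hy (hr y)
    have := hmax (insert y M) ⟨insert_subset hy hM.1, ?_⟩
    · rw [card_insert_of_notMem hyM] at this
      omega
    · intro x hx z hz hxz
      rcases mem_insert.1 hx with hx' | hx' <;> rcases mem_insert.1 hz with hz' | hz'
      · exact absurd (hx'.trans hz'.symm) hxz
      · exact fun h => hcon z hz' hy (hs _ _ (hx' ▸ h))
      · exact fun h => hcon x hx' hy (hz' ▸ h)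
      · exact hM.2 x hx' z hz' hxz
  exact (card_le_card hcov).trans (card_biUnion_le_card_mul _ _ _ fun x hx => hD x (hM.1 hx))

/-- Two pairs of vertices touch if they share a vertex or some vertex of one is adjacent to some
vertex of the other. -/
def SimpleGraph.PairTouch {V : Type*} (G : SimpleGraph V) (p q : V × V) : Prop :=
  ∃ a b, (a = p.1 ∨ a = p.2) ∧ (b = q.1 ∨ b = q.2) ∧ (a = b ∨ G.Adj a b)

/-- In a graph of maximum degree `k` an edge is touched by at most `4 (k + 1) ^ 2` edges: at most
`2 (k + 1)` vertices are in or next to it, and each is the first or the second entry of at most `k`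
ordered edges. -/
theorem card_pairTouch_le {V : Type*} [Fintype V] [DecidableEq V] (G : SimpleGraph V)
    [DecidableRel G.Adj] {k : ℕ} (hk : ∀ v, G.degree v ≤ k) (A : Finset (V × V))
    (hA : ∀ q ∈ A, G.Adj q.1 q.2) (p : V × V) [DecidablePred (G.PairTouch p)] :
    #{q ∈ A | G.PairTouch p q} ≤ 4 * (k + 1) ^ 2 := by
  let N : Finset V := insert p.1 (G.neighborFinset p.1) ∪ insert p.2 (G.neighborFinset p.2)
  have hN : #N ≤ 2 * (k + 1) := by
    refine (card_union_le _ _).trans ?_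
    have h1 := card_insert_le p.1 (G.neighborFinset p.1)
    have h2 := card_insert_le p.2 (G.neighborFinset p.2)
    rw [SimpleGraph.card_neighborFinset_eq_degree] at h1 h2
    have := hk p.1
    have := hk p.2
    omega
  have hsub : ({q ∈ A | G.PairTouch p q} : Finset _) ⊆
      N.biUnion fun b => ({b} ×ˢ G.neighborFinset b) ∪ (G.neighborFinset b ×ˢ {b}) := by
    intro q hq
    rw [mem_filter] at hq
    obtain ⟨hqA, a, b, ha, hb, hab⟩ := hq
    have hadj := hA q hqA
    simp only [mem_biUnion, mem_union, mem_product, mem_singleton, SimpleGraph.mem_neighborFinset]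
    refine ⟨b, ?_, ?_⟩
    · simp only [N, mem_union, mem_insert, SimpleGraph.mem_neighborFinset]
      rcases ha with rfl | rfl <;> rcases hab with h | h <;> simp [h]
    · rcases hb with rfl | rfl
      · exact Or.inl ⟨rfl, hadj⟩
      · exact Or.inr ⟨hadj.symm, rfl⟩
  refine (card_le_card hsub).trans ((card_biUnion_le_card_mul _ _ (2 * (k + 1)) ?_).trans ?_)
  · intro b _
    refine (card_union_le _ _).trans ?_
    rw [card_product, card_product, card_singleton, SimpleGraph.card_neighborFinset_eq_degree]
    have := hk b
    omega
  · calc #N * (2 * (k + 1)) ≤ 2 * (k + 1) * (2 * (k + 1)) := Nat.mul_le_mul_right _ hN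
      _ = 4 * (k + 1) ^ 2 := by ring

/-- In a graph of maximum degree `k`, a cut with many edges contains an induced matching
`u_j — v_j`, of a size that is the number of its edges divided by `4 (k + 1) ^ 2`, rounded up. -/
theorem exists_induced_matching {V : Type*} [Fintype V] [DecidableEq V] (G : SimpleGraph V)
    [DecidableRel G.Adj] {k : ℕ} (hk : ∀ v, G.degree v ≤ k) (S : Finset V) {m : ℕ}
    (hm : m * (4 * (k + 1) ^ 2) < #((S ×ˢ Sᶜ).filter fun q => G.Adj q.1 q.2)) :
    ∃ u v : Fin (m + 1) → V, (∀ j, u j ∈ S) ∧ (∀ j, v j ∉ S) ∧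
      (∀ i j, ¬ G.Adj (u i) (u j)) ∧ (∀ i j, ¬ G.Adj (v i) (v j)) ∧
      ∀ i j, G.Adj (u i) (v j) ↔ i = j := by
  classical
  set A := (S ×ˢ Sᶜ).filter fun q => G.Adj q.1 q.2 with hAdef
  have hA : ∀ q ∈ A, G.Adj q.1 q.2 := fun q hq => (mem_filter.1 hq).2
  obtain ⟨M, hMA, hind, hcard⟩ := exists_independent_subset G.PairTouch
    (fun x => ⟨x.1, x.1, Or.inl rfl, Or.inl rfl, Or.inl rfl⟩)
    (fun x y ⟨a, b, ha, hb, hab⟩ => ⟨b, a, hb, ha, hab.imp Eq.symm SimpleGraph.Adj.symm⟩)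
    A _ (fun x _ => card_pairTouch_le G hk A hA x)
  have hM : m + 1 ≤ #M := Nat.lt_of_mul_lt_mul_right (hm.trans_le hcard)
  obtain ⟨M', hM', hc⟩ := exists_subset_card_eq hM
  let e : Fin (m + 1) ≃ M' := (M'.equivFinOfCardEq hc).symm
  have hmem : ∀ j, (e j).1 ∈ A := fun j => hMA (hM' (e j).2)
  have hST : ∀ j, (e j).1.1 ∈ S ∧ (e j).1.2 ∉ S := fun j => by
    have := (mem_filter.1 (hmem j)).1
    rw [mem_product, mem_compl] at this
    exact this
  have hno : ∀ i j, i ≠ j → ¬ G.PairTouch (e i).1 (e j).1 := fun i j hij =>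
    hind _ (hM' (e i).2) _ (hM' (e j).2) fun h => hij (e.injective (Subtype.ext h))
  refine ⟨fun j => (e j).1.1, fun j => (e j).1.2, fun j => (hST j).1, fun j => (hST j).2,
    fun i j h => ?_, fun i j h => ?_, fun i j => ⟨fun h => ?_, ?_⟩⟩
  · rcases eq_or_ne i j with rfl | hij
    · exact G.loopless.irrefl _ h
    · exact hno i j hij ⟨_, _, Or.inl rfl, Or.inl rfl, Or.inr h⟩
  · rcases eq_or_ne i j with rfl | hij
    · exact G.loopless.irrefl _ h
    · exact hno i j hij ⟨_, _, Or.inr rfl, Or.inr rfl, Or.inr h⟩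
  · by_contra hij
    exact hno i j hij ⟨_, _, Or.inl rfl, Or.inr rfl, Or.inr h⟩
  · rintro rfl
    exact hA _ (hmem i)

/-! ### The width lower bound -/

/-- A sum over ordered adjacent pairs of linear combinations of indicators of vertices is a sum over
the pairs of these vertices. -/
theorem sum_adj_mul_sum_ite {n : ℕ} (G : SimpleGraph (Fin n)) [DecidableRel G.Adj] {J R : Type*}
    [Fintype J] [CommRing R] (e f : J → Fin n) (z w : J → R) :
    ∑ p : Fin n × Fin n with G.Adj p.1 p.2,
      (∑ i, if p.1 = e i then z i else 0) * (∑ j, if p.2 = f j then w j else 0) =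
    ∑ i, ∑ j, if G.Adj (e i) (f j) then z i * w j else 0 := by
  simp only [sum_mul_sum]
  rw [sum_comm]
  refine sum_congr rfl fun i _ => ?_
  rw [sum_comm]
  refine sum_congr rfl fun j _ => ?_
  rw [sum_filter, sum_eq_single (e i, f j)]
  · simp
  · rintro ⟨x, y⟩ _ hxy
    by_cases h1 : x = e i <;> by_cases h2 : y = f j
    · exact absurd (Prod.ext h1 h2) hxy
    all_goals simp [h1, h2]
  · simp

open MvPolynomial in
/-- Substituting `u_j`, `v_j` for the endpoints of an induced matching and `0` for all other
variables turns `Q_G` into `∑ j, u_j v_j`. -/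
theorem aeval_graphQuadratic_of_induced_matching {F : Type*} [Field F] [CharZero F] {n : ℕ}
    (G : SimpleGraph (Fin n)) {J : Type*} [Fintype J] [DecidableEq J] (u v : J → Fin n)
    (huu : ∀ i j, ¬ G.Adj (u i) (u j)) (hvv : ∀ i j, ¬ G.Adj (v i) (v j))
    (huv : ∀ i j, G.Adj (u i) (v j) ↔ i = j) :
    aeval (fun x : Fin n => (∑ j, if x = u j then C (X j) else 0) + ∑ j, if x = v j then X j else 0)
      (graphQuadratic F G) = (∑ j, C (X j) * X j : MvPolynomial J (MvPolynomial J F)) := by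
  classical
  have hvu : ∀ i j, G.Adj (v i) (u j) ↔ j = i := fun i j => by rw [G.adj_comm, huv]
  refine mul_left_cancel₀ two_ne_zero ?_
  rw [two_mul_aeval_graphQuadratic]
  simp only [add_mul, mul_add, sum_add_distrib]
  have key := sum_adj_mul_sum_ite G (J := J) (R := MvPolynomial J (MvPolynomial J F))
  rw [key u u, key u v, key v u, key v v]
  simp [huu, hvv, huv, hvu, two_mul, mul_comm]

open MvPolynomial in
/-- A program computing `Q_G ^ d` is wide at a layer where the variables read so far are separated
from the others by an induced matching of `m + 1` edges. -/
theorem choose_le_size_of_induced_matching {F : Type*} [Field F] [CharZero F] {n m d : ℕ}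
    (G : SimpleGraph (Fin n)) {π : Equiv.Perm (Fin n)} (P : ROABP F π)
    (hP : P.poly = graphQuadratic F G ^ d) (c : Fin (n + 1)) (u v : Fin (m + 1) → Fin n)
    (hu : ∀ j, (π.symm (u j)).castSucc < c) (hv : ∀ j, c ≤ (π.symm (v j)).castSucc)
    (huu : ∀ i j, ¬ G.Adj (u i) (u j)) (hvv : ∀ i j, ¬ G.Adj (v i) (v j))
    (huv : ∀ i j, G.Adj (u i) (v j) ↔ i = j) :
    (d + m).choose m ≤ P.size c := by
  classical
  let J := Fin (m + 1)
  let R := MvPolynomial J (MvPolynomial J F)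
  let ιA : MvPolynomial J F →ₐ[F] R := IsScalarTower.toAlgHom F (MvPolynomial J F) R
  let ιB : MvPolynomial J F →ₐ[F] R := mapAlgHom (Algebra.ofId F (MvPolynomial J F))
  obtain ⟨a, b, ha, hb, hab⟩ := P.exists_aeval_poly_eq_sum_mul c
    (fun x : Fin n => ((∑ j, if x = u j then C (X j) else 0) +
      ∑ j, if x = v j then X j else 0 : R)) ιA.range ιB.range
    (fun i hi => by
      have : ∀ j, π i ≠ v j := fun j h => by
        have := hv j
        rw [← h, Equiv.symm_apply_apply] at this
        exact absurd hi this.not_gt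
      simp only [this, if_false, sum_const_zero, add_zero]
      refine Subalgebra.sum_mem _ fun j _ => ?_
      split_ifs
      · exact ⟨X j, rfl⟩
      · exact Subalgebra.zero_mem _)
    (fun i hi => by
      have : ∀ j, π i ≠ u j := fun j h => by
        have := hu j
        rw [← h, Equiv.symm_apply_apply] at this
        exact absurd this hi.not_gt
      simp only [this, if_false, sum_const_zero, zero_add]
      refine Subalgebra.sum_mem _ fun j _ => ?_
      split_ifs
      · exact ⟨X j, map_X _ _⟩
      · exact Subalgebra.zero_mem _)
  rw [hP, map_pow, aeval_graphQuadratic_of_induced_matching G u v huu hvv huv] at hab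
  choose a' ha' using ha
  choose b' hb' using hb
  refine choose_le_of_sum_mul_pow_eq a' b' (hab.trans (sum_congr rfl fun c _ => ?_))
  rw [← ha', ← hb']
  rfl

theorem exists_adj_of_isExpander {n k : ℕ} {h : ℝ} (hh : 0 < h) (hn : 2 ≤ n)
    {G : SimpleGraph (Fin n)} (hG : IsExpander G k h) : ∃ x y, G.Adj x y := by
  classical
  have h1 := hG.expansion {⟨0, by omega⟩} (by simpa using hn)
  rw [card_singleton, Nat.cast_one, mul_one] at h1
  have h2 := Nat.cast_pos.1 (hh.trans_le h1)
  obtain ⟨p, hp⟩ := card_ne_zero.1 h2.ne'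
  exact ⟨p.1, p.2, (mem_filter.1 hp).2⟩

open MvPolynomial in
theorem totalDegree_graphQuadratic {F : Type*} [Field F] {n : ℕ} {G : SimpleGraph (Fin n)}
    (hG : ∃ x y, G.Adj x y) : (graphQuadratic F G).totalDegree = 2 := by
  classical
  apply le_antisymm
  · refine totalDegree_finsetSum_le fun p _ => ?_
    exact (totalDegree_mul _ _).trans (by simp [totalDegree_X])
  · obtain ⟨x, y, hxy, hlt⟩ : ∃ x y, G.Adj x y ∧ x < y := by
      obtain ⟨x, y, hxy⟩ := hG
      rcases lt_or_gt_of_ne hxy.ne with h | h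
      · exact ⟨x, y, hxy, h⟩
      · exact ⟨y, x, hxy.symm, h⟩
    have hmon : ∀ p : Fin n × Fin n, (X p.1 * X p.2 : MvPolynomial (Fin n) F) =
        monomial (Finsupp.single p.1 1 + Finsupp.single p.2 1) 1 := fun p => by
      rw [X, X, monomial_mul, one_mul]
    have hne : coeff (Finsupp.single x 1 + Finsupp.single y 1) (graphQuadratic F G) ≠ 0 := by
      rw [graphQuadratic, coeff_sum, sum_eq_single (x, y)]
      · rw [hmon, coeff_monomial, if_pos rfl]; exact one_ne_zero
      · rintro ⟨a, b⟩ hp hpne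
        rw [hmon, coeff_monomial, if_neg]
        intro heq
        have hab : a < b := (mem_filter.1 hp).2.1
        have ha := DFunLike.congr_fun heq a
        have hb := DFunLike.congr_fun heq b
        simp only [Finsupp.add_apply, Finsupp.single_apply] at ha hb
        apply hpne
        grind
      · intro h
        exact absurd (mem_filter.2 ⟨mem_univ _, hlt, hxy⟩) h
    have := le_totalDegree (mem_support_iff.2 hne)
    rw [Finsupp.sum_add_index' (by simp) (by simp)] at this
    simpa using this

/-- The lower bound at the middle layer, whose cut the expansion hypothesis makes large. -/
theorem choose_le_width_of_isExpander {F : Type*} [Field F] [CharZero F] {n k m d : ℕ} {h : ℝ}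
    {G : SimpleGraph (Fin n)} (hG : IsExpander G k h)
    (hm : (m * (4 * (k + 1) ^ 2) : ℝ) < h * (n / 2 : ℕ)) {π : Equiv.Perm (Fin n)}
    (P : ROABP F π) (hP : P.poly = graphQuadratic F G ^ d) : (d + m).choose m ≤ P.width := by
  classical
  let c : Fin (n + 1) := ⟨n / 2, by omega⟩
  let S : Finset (Fin n) := (univ.filter fun i : Fin n => i.castSucc < c).map π.toEmbedding
  have hmemS : ∀ x, x ∈ S ↔ (π.symm x).castSucc < c := fun x => by
    simp [S, mem_map_equiv]
  have hS : #S = n / 2 := by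
    rw [card_map]
    have : (univ.filter fun i : Fin n => i.castSucc < c).map Fin.valEmbedding = range (n / 2) := by
      ext a
      simp only [mem_map, mem_filter, mem_univ, true_and, Fin.valEmbedding_apply, mem_range, c,
        Fin.lt_def, Fin.val_castSucc]
      exact ⟨fun ⟨i, hi, e⟩ => e ▸ hi, fun ha => ⟨⟨a, by omega⟩, ha, rfl⟩⟩
    rw [← card_map Fin.valEmbedding, this, card_range]
  have hexp := hG.expansion S (by rw [hS, Fintype.card_fin]; omega)
  rw [hS] at hexp
  have hlt : m * (4 * (k + 1) ^ 2) < #((S ×ˢ Sᶜ).filter fun q => G.Adj q.1 q.2) := by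
    have hlt := hm.trans_le hexp
    norm_cast at hlt
    convert! hlt
  obtain ⟨u, v, hu, hv, huu, hvv, huv⟩ := exists_induced_matching G (k := k) (m := m)
    (fun x => by convert! hG.degree_le x) S hlt
  exact (choose_le_size_of_induced_matching G P hP c u v (fun j => (hmemS _).1 (hu j))
    (fun j => not_lt.1 fun h => hv j ((hmemS _).2 h)) huu hvv huv).trans (P.size_le_width c)

/-! ### Choice of the constants -/

theorem mainTheorem7 :
    -- constant-degree expanders exist on every number of vertices
    (∃ (k : ℕ) (h : ℝ), 0 < h ∧ ∀ n : ℕ, ∃ G : SimpleGraph (Fin n), IsExpander G k h) ∧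
    -- the bounds hold for all of them, with constants depending on the parameters `k`, `h` only
    (∀ (k : ℕ) (h : ℝ), 0 < h →
      ∃ (C c : ℝ) (n₀ : ℕ), 0 < C ∧ 0 < c ∧
        ∀ n : ℕ, n₀ ≤ n → ∀ G : SimpleGraph (Fin n), IsExpander G k h →
          ∃ m : ℕ, c * (n : ℝ) ≤ (m : ℝ) ∧
            ∀ (F : Type*) [Field F] [CharZero F],
              (graphQuadratic F G).totalDegree = 2 ∧
              (∀ π : Equiv.Perm (Fin n), ∃ P : ROABP F π,
                P.poly = graphQuadratic F G ∧ (P.width : ℝ) ≤ C * (n : ℝ)) ∧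
              (∀ (d : ℕ) (π : Equiv.Perm (Fin n)) (P : ROABP F π),
                P.poly = graphQuadratic F G ^ d → (d + m).choose m ≤ P.width)) := by
  refine ⟨⟨16, 1 / 20, by norm_num, exists_isExpander⟩, fun k h hh => ?_⟩
  set D : ℝ := 4 * (k + 1) ^ 2
  have hDpos : 0 < D := by positivity
  -- the middle cut has at least `h * (n / 2) ≥ h * n / 3` edges, so that any `m < h * n / (3 * D)`
  -- is admissible; `n ≥ 12 * D / h` leaves room for a natural number `m ≥ h * n / (6 * D)`
  refine ⟨3, h / (6 * D), max 2 ⌈12 * D / h⌉₊, by norm_num, by positivity, fun n hn G hG => ?_⟩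
  have hn2 : 2 ≤ n := (le_max_left _ _).trans hn
  have hnD : 12 * D ≤ n * h := by
    have : 12 * D / h ≤ n := (Nat.le_ceil _).trans (by exact_mod_cast (le_max_right _ _).trans hn)
    exact (div_le_iff₀ hh).1 this
  refine ⟨⌈h / (6 * D) * n⌉₊, Nat.le_ceil _, fun F _ _ =>
    ⟨totalDegree_graphQuadratic (exists_adj_of_isExpander hh hn2 hG), fun π => ?_,
      fun d π P hP => choose_le_width_of_isExpander hG ?_ P hP⟩⟩
  · obtain ⟨P, hP, hw⟩ := exists_roabp_graphQuadratic (F := F) G π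
    refine ⟨P, hP, ?_⟩
    rw [hw]
    have : n + 2 ≤ 3 * n := by omega
    exact_mod_cast this
  · have h1 : (⌈h / (6 * D) * n⌉₊ : ℝ) < h / (6 * D) * n + 1 := Nat.ceil_lt_add_one (by positivity)
    have h2 : (n : ℝ) ≤ 3 * (n / 2 : ℕ) := by
      have : n ≤ 3 * (n / 2) := by omega
      exact_mod_cast this
    have h3 : h / (6 * D) * n * D = h * n / 6 := by field_simp
    calc (⌈h / (6 * D) * n⌉₊ : ℝ) * D < (h / (6 * D) * n + 1) * D := by gcongr
      _ = h * n / 6 + D := by rw [add_mul, h3, one_mul]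
      _ ≤ h * n / 3 := by linarith
      _ ≤ h * (n / 2 : ℕ) := by nlinarith
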